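/- Let $L\ge 2$ and let $\Omega=\{0,1\}^L$ be the set of configurations $\eta=(\eta(1),\dots,\eta(L))$ on the ring with sites $1,\dots,L$ (site $L+1$ is site $1$). Let $\Omega_N$ be the set of configurations with $\sum_k\eta(k)=N$, and $\hat{\mathbf 1}_N=\sum_{\eta\in\Omega_N}|\eta\rangle\langle\eta|$, acting on $(\mathbb C^2)^{\otimes L}$ with basis $(|\eta\rangle)_{\eta\in\Omega}$. Let $w,q,z\in\mathbb C$ with $q\ne0$, $z\neq 0$. (For $w>0$, $q>0$, $q\neq 1$ and $z>0$ these are the time scale and asymmetry of the partially asymmetric simple exclusion process (ASEP), with jump rates $wq$ to the right and $wq^{-1}$ to the left, and a fugacity.) For $\alpha,\beta\ne0$ let $$H(q,\alpha,\beta)=\sum_{k=1}^{L-1}h_{k,k+1}(\alpha)+h_{L,1}(\alpha\beta),$$ $$h_{k,l}(a)=-w\left[a\,\sigma_k^+\sigma_l^--q\,\hat n_k\hat\upsilon_l+a^{-1}\sigma_k^-\sigma_l^+-q^{-1}\hat\upsilon_k\hat n_l\right],$$ where $\sigma^-_k$ and $\sigma^+_k$ create and annihilate a particle at site $k$, $\hat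 n_k|\eta\rangle=\eta(k)|\eta\rangle$ and $\hat\upsilon_k=1-\hat n_k$. For integers $M,N\ge0$ let $\bar H^M_N:=\hat{\mathbf 1}_N\,H(q,q,q^{-2M})\,\hat{\mathbf 1}_N$. For $\vec x\in\Omega_K$, identified with its set $\{x_1<\dots<x_K\}$ of occupied sites, let $$|\bar\mu_{\vec x}\rangle=\prod_{j=1}^K z^{-1}q^{-\sum_{i<x_j}\hat n_i+\sum_{i>x_j}\hat n_i}\,\hat n_{x_j}\,|z\rangle,\qquad |z\rangle=\sum_{\eta\in\Omega} z^{\sum_k\eta(k)}|\eta\rangle,$$ be the unnormalized shock/antishock measure with $K$ shocks at $x_1,\dots,x_K$ (the sites $x_j$ are occupied, and the fugacity is $zq^{2l-K}$ between $x_l$ and $x_{l+1}$), and let $|\bar\mu^N_{\vec x}\rangle=\hat{\mathbf 1}_N|\bar\mu_{\vec x}\rangle$. Then for all integers $K,N\ge0$: 1. $\bar H^K_N$ is the generator of the $N$-particle ASEP on the ring, conditioned locally at the bond $(L,1)$ with driving strength $\bar s=-2K\ln q$: it is the restriction to $N$ particles of the matrix $H$ with $-\sum_{\eta'}f(\eta')H_{\eta'\eta}=\sum_{k=1}^{L}\left[w_{\bar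 s}^{k,k+1}(\eta)f(\eta^{k,k+1})-w_0^{k,k+1}(\eta)f(\eta)\right]$, where $\eta^{k,k+1}$ is $\eta$ with the contents of sites $k$ and $k+1$ exchanged, jumps to the right (left) have rate $wq$ ($wq^{-1}$), and in $w_{\bar s}$ (but not in $w_0$) those across the bond $(L,1)$ carry the additional weight $e^{\bar s}$ ($e^{-\bar s}$). Likewise $\bar H^N_K$ is the generator of the $K$-particle ASEP conditioned at the bond $(L,1)$ with driving strength $\bar s'=-2N\ln q$. 2. For every $\vec x\in\Omega_K$ and every real $t$, $$e^{-\bar H^K_N t}\,|\bar\mu^N_{\vec x}\rangle=\sum_{\vec y\in\Omega_K}\bar P^N(\vec y,t\,|\,\vec x,0)\,|\bar\mu^N_{\vec y}\rangle,\qquad \bar P^N(\vec y,t\,|\,\vec x,0):=\langle\vec y|\,e^{-\bar H^N_K t}\,|\vec x\rangle,$$ so the weights are the boundary-conditioned $K$-particle transition probabilities with driving strength $\bar s'=-2N\ln q$. -/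

import Mathlib

noncomputable section

namespace ASEP

/-! ### Configurations -/

/-- Configurations `η = (η(1), …, η(L))` of occupation numbers in `{0, 1}`; the site `k` of the
text is the index `k - 1 : Fin L`. -/
abbrev Config (L : ℕ) : Type := Fin L → Fin 2

/-- The particle number `N(η) = ∑ₖ η(k)`. -/
def particleNumber {L : ℕ} (η : Config L) : ℕ := ∑ k, (η k : ℕ)

/-- `Ω_N`: the configurations with exactly `N` particles. -/
def sector (L N : ℕ) : Finset (Config L) := {η | particleNumber η = N}

/-- The right neighbour of a site on the ring: `k ↦ k + 1` for `k < L`, and `L ↦ 1`. -/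
def next {L : ℕ} (k : Fin L) : Fin L := finRotate L k

/-- `η^{k,k+1}`: the configuration with the contents of the sites `k` and `k + 1` (cyclically)
exchanged. -/
def exchange {L : ℕ} (k : Fin L) (η : Config L) : Config L := η ∘ Equiv.swap k (next k)

/-! ### The weighted rates and the generator of the conditioned process -/

/-- The rate of the bond `(k, k + 1)` in the configuration `η` when jumps to the right have rate
`w q` and carry the weight `a`, and jumps to the left have rate `w q⁻¹` and carry `a⁻¹`. -/
def bondRate {L : ℕ} (w q a : ℂ) (k : Fin L) (η : Config L) : ℂ :=
  w * (q * a * (η k : ℕ) * (1 - (η (next k) : ℕ))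
    + q⁻¹ * a⁻¹ * (1 - (η k : ℕ)) * (η (next k) : ℕ))

/-- The weight of a jump to the right across the bond `(k, k + 1)`: `e^s` on the bonds
`1 ≤ k ≤ L - 1`, and `e^{s + sbar}` on the boundary bond `(L, 1)`. -/
def jumpWeight {L : ℕ} (s sbar : ℂ) (k : Fin L) : ℂ :=
  if (k : ℕ) + 1 = L then Complex.exp (s + sbar) else Complex.exp s

/-- The generator of the periodic ASEP conditioned with driving strength `s` on all bonds and
additional driving strength `sbar` on the bond `(L, 1)`. It is the matrix `H` for which
`(𝓛 f)(η) = ∑ₖ (w_{s,sbar}^{k,k+1}(η) f(η^{k,k+1}) - w^{k,k+1}(η) f(η))` is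
`- ∑_{η'} f(η') H_{η',η}`: jump rates are weighted, escape rates are not. -/
def conditionedGenerator (L : ℕ) (w q s sbar : ℂ) : Matrix (Config L) (Config L) ℂ :=
  Matrix.of fun η' η => ∑ k : Fin L,
    ((if η' = η then bondRate w q 1 k η else 0)
      - (if η' = exchange k η then bondRate w q (jumpWeight s sbar k) k η else 0))

/-! ### The same generators in the tensor basis -/

/-- `u_k = 𝟙^{⊗(k-1)} ⊗ u ⊗ 𝟙^{⊗(L-k)}` on `(ℂ²)^{⊗L}`, in the basis of the configurations. -/
def site {L : ℕ} (u : Matrix (Fin 2) (Fin 2) ℂ) (k : Fin L) :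
    Matrix (Config L) (Config L) ℂ :=
  Matrix.of fun η' η => if ∀ i, i ≠ k → η' i = η i then u (η' k) (η k) else 0

/-- `σ⁺`, which annihilates a particle: `σ⁺|1) = |0)`. -/
def sigmaPlus : Matrix (Fin 2) (Fin 2) ℂ := !![0, 1; 0, 0]

/-- `σ⁻`, which creates a particle: `σ⁻|0) = |1)`. -/
def sigmaMinus : Matrix (Fin 2) (Fin 2) ℂ := !![0, 0; 1, 0]

/-- The projector `n̂` on an occupied site. -/
def occ : Matrix (Fin 2) (Fin 2) ℂ := !![0, 0; 0, 1]

/-- The projector `υ̂` on an empty site. -/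
def emp : Matrix (Fin 2) (Fin 2) ℂ := !![1, 0; 0, 0]

/-- The hopping matrix of the bond `(k, k + 1)` (cyclically) with parameter `a`. -/
def hopping {L : ℕ} (w q a : ℂ) (k : Fin L) : Matrix (Config L) (Config L) ℂ :=
  -w • (a • (site sigmaPlus k * site sigmaMinus (next k))
    - q • (site occ k * site emp (next k))
    + a⁻¹ • (site sigmaMinus k * site sigmaPlus (next k))
    - q⁻¹ • (site emp k * site occ (next k)))

/-- `H(q, α, β) = ∑_{k=1}^{L-1} h_{k,k+1}(q, α) + h_{L,1}(q, α, β)`; in the boundary term the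
parameter `α` is replaced by `α β`. -/
def generator (L : ℕ) (w q α β : ℂ) : Matrix (Config L) (Config L) ℂ :=
  ∑ k : Fin L, hopping w q (if (k : ℕ) + 1 = L then α * β else α) k

/-- The projector `𝟏_N = ∑_{η ∈ Ω_N} |η⟩⟨η|`. -/
def projector (L N : ℕ) : Matrix (Config L) (Config L) ℂ :=
  Matrix.diagonal fun η => if η ∈ sector L N then 1 else 0

/-- The `N`-particle restriction `𝟏_N A 𝟏_N` of a matrix. -/
def restrict {L : ℕ} (N : ℕ) (A : Matrix (Config L) (Config L) ℂ) :
    Matrix (Config L) (Config L) ℂ :=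
  projector L N * A * projector L N

/-- `Hbar^M_N = 𝟏_N H(q, q, q^{-2M}) 𝟏_N`: here `N` is the particle number, and `M` sets the
strength of the conditioning at the boundary bond. -/
def localGenerator (L N M : ℕ) (w q : ℂ) : Matrix (Config L) (Config L) ℂ :=
  restrict N (generator L w q q (q ^ (-(2 * M : ℤ))))

/-- The semigroup `e^{-A t}` (matrix exponential). -/
def evolution {L : ℕ} (A : Matrix (Config L) (Config L) ℂ) (t : ℝ) :
    Matrix (Config L) (Config L) ℂ :=
  NormedSpace.exp (-(t : ℂ) • A)

/-! ### Shock/antishock measures -/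

/-- The vector `|z⟩ = |z)^{⊗L}` with `|z) = (1, z)ᵀ`, the unnormalized Bernoulli product measure
of fugacity `z`. -/
def homogeneous (L : ℕ) (z : ℂ) : Config L → ℂ :=
  fun η => ∏ k, if η k = 1 then z else 1

/-- The diagonal matrix `z⁻¹ q^{-∑_{i<k} n̂_i + ∑_{i>k} n̂_i} n̂_k`. -/
def shockFactor {L : ℕ} (q z : ℂ) (k : Fin L) : Config L → ℂ :=
  fun η => z⁻¹ * q ^ (-(∑ i with i < k, ((η i : ℕ) : ℤ)) + ∑ i with k < i, ((η i : ℕ) : ℤ))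
    * (η k : ℕ)

/-- The unnormalized shock/antishock measure: the product over the occupied sites of `x` of the
(diagonal, hence commuting) shock factors, applied to `|z⟩`. -/
def shockMeasure {L : ℕ} (q z : ℂ) (x : Config L) : Config L → ℂ :=
  fun η => (∏ k with x k = 1, shockFactor q z k η) * homogeneous L z η

/-- The shock/antishock measure restricted to `N` particles, `𝟏_N |μbar_x⟩`. -/
def shockMeasureN {L : ℕ} (N : ℕ) (q z : ℂ) (x : Config L) : Config L → ℂ :=
  Matrix.mulVec (projector L N) (shockMeasure q z x)

end ASEP

end

namespace ASEP

variable {L : ℕ}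

/-! The theorem is a duality between two conditioned processes. Let `D` be the matrix whose column
`x` is the shock measure at `x`. It suffices that `D` intertwines the two local generators, since
this passes to the exponentials, and column `x` of the exponentiated relation is the claim. Up to a
factor depending only on particle numbers, `D η x` is the indicator that `η` covers `x` times `q ^
S(η, x)`, with `S` bilinear and built on the antisymmetric kernel sgn(i - k). Moving a particle or a
shock across a bulk bond changes `S` only through the occupations at that bond. Across the bond (L,
1), sgn jumps by an extra 2, which yields factors `q ^ (±2K)` or `q ^ (±2N)`; the boundary weights
cancel exactly these. Bond by bond the intertwining fails only by a discrete gradient of `η - x`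
(`bond_intertwining`), which sums to zero around the ring (`generator_mul_shockMatrix`). -/

lemma val_next (k : Fin L) : (next k : ℕ) = if (k : ℕ) + 1 = L then 0 else (k : ℕ) + 1 := by
  cases L with
  | zero => exact k.elim0
  | succ n =>
    rw [next, coe_finRotate]
    simp only [Fin.ext_iff, Fin.val_last, Nat.add_right_cancel_iff]

lemma next_ne (hL : 2 ≤ L) (k : Fin L) : next k ≠ k := by
  intro h
  have h1 := val_next k
  rw [h] at h1
  split_ifs at h1 <;> omega

lemma exchange_exchange (k : Fin L) (η : Config L) : exchange k (exchange k η) = η := by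
  funext i
  simp [exchange]

lemma eq_exchange_comm (k : Fin L) (η ζ : Config L) : η = exchange k ζ ↔ ζ = exchange k η := by
  constructor <;> rintro rfl <;> rw [exchange_exchange]

@[simp] lemma exchange_self (k : Fin L) (η : Config L) : exchange k η k = η (next k) := by
  simp [exchange]

@[simp] lemma exchange_next (k : Fin L) (η : Config L) : exchange k η (next k) = η k := by
  simp [exchange]

lemma exchange_of_ne {k i : Fin L} (η : Config L) (h : i ≠ k) (h' : i ≠ next k) :
    exchange k η i = η i := by
  simp [exchange, Equiv.swap_apply_of_ne_of_ne h h']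

@[simp] lemma particleNumber_exchange (k : Fin L) (η : Config L) :
    particleNumber (exchange k η) = particleNumber η :=
  Equiv.sum_comp (Equiv.swap k (next k)) fun i => (η i : ℕ)

@[simp] lemma homogeneous_exchange (z : ℂ) (k : Fin L) (η : Config L) :
    homogeneous L z (exchange k η) = homogeneous L z η :=
  Equiv.prod_comp (Equiv.swap k (next k)) fun i => if η i = 1 then z else 1

lemma mem_sector {N : ℕ} {η : Config L} : η ∈ sector L N ↔ particleNumber η = N := by
  simp [sector]

/-! ### The generator in the configuration basis -/

lemma site_mul_site_apply (u v : Matrix (Fin 2) (Fin 2) ℂ) {k l : Fin L} (hkl : k ≠ l)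
    (η ζ : Config L) :
    (site u k * site v l) η ζ =
      if ∀ i, i ≠ k → i ≠ l → η i = ζ i then u (η k) (ζ k) * v (η l) (ζ l) else 0 := by
  -- The right factor acts first and changes only site `l`, so this is the only possible
  -- intermediate configuration.
  rw [Matrix.mul_apply, Finset.sum_eq_single (Function.update ζ l (η l))]
  · simp only [site, Matrix.of_apply, ne_eq]
    have h1 : (∀ i, ¬ i = k → η i = Function.update ζ l (η l) i) ↔
        ∀ i, i ≠ k → i ≠ l → η i = ζ i := by
      refine forall_congr' fun i => imp_congr_right fun _ => ?_
      by_cases hi : i = l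
      · subst hi; simp
      · simp [hi]
    have h2 : ∀ i, ¬ i = l → Function.update ζ l (η l) i = ζ i := fun i hi => by simp [hi]
    simp only [h1, if_pos h2, Function.update_self, Function.update_of_ne hkl]
    simp
  · intro ξ _ hξ
    simp only [site, Matrix.of_apply, mul_ite, mul_zero, ite_mul, zero_mul]
    split_ifs with h1 h2
    · refine absurd (funext fun i => ?_) hξ
      by_cases hi : i = l
      · subst hi; simp [h2 i hkl.symm]
      · simp [hi, h1 i hi]
    all_goals rfl
  · simp

/-- The generator whose jumps across the bond `(k, k + 1)` carry the weight `a k`. -/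
noncomputable def weightedGenerator (w q : ℂ) (a : Fin L → ℂ) : Matrix (Config L) (Config L) ℂ :=
  Matrix.of fun η' η => ∑ k : Fin L,
    ((if η' = η then bondRate w q 1 k η else 0)
      - (if η' = exchange k η then bondRate w q (a k) k η else 0))

/-- With parameter `q * a`, the hopping terms have coefficients `q * a` and `q⁻¹ * a⁻¹`: the ASEP
rates times the jump weights. -/
lemma hopping_apply (hL : 2 ≤ L) (w q a : ℂ) (k : Fin L) (η ζ : Config L) :
    hopping w q (q * a) k η ζ = (if η = ζ then bondRate w q 1 k ζ else 0)
      - (if η = exchange k ζ then bondRate w q a k ζ else 0) := by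
  have hne := next_ne hL k
  simp only [hopping, Matrix.smul_apply, Matrix.sub_apply, Matrix.add_apply,
    site_mul_site_apply _ _ hne.symm, smul_eq_mul]
  by_cases hout : ∀ i, i ≠ k → i ≠ next k → η i = ζ i
  · have h1 : η = ζ ↔ η k = ζ k ∧ η (next k) = ζ (next k) := by
      refine ⟨fun h => by simp [h], fun h => funext fun i => ?_⟩
      by_cases hi : i = k
      · rw [hi, h.1]
      by_cases hi' : i = next k
      · rw [hi', h.2]
      exact hout i hi hi'
    have h2 : η = exchange k ζ ↔ η k = ζ (next k) ∧ η (next k) = ζ k := by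
      refine ⟨fun h => by simp [h], fun h => funext fun i => ?_⟩
      by_cases hi : i = k
      · rw [hi, h.1, exchange_self]
      by_cases hi' : i = next k
      · rw [hi', h.2, exchange_next]
      rw [exchange_of_ne ζ hi hi', hout i hi hi']
    simp only [if_pos hout, h1, h2, bondRate]
    generalize η k = a1
    generalize η (next k) = a2
    generalize ζ k = b1
    generalize ζ (next k) = b2
    fin_cases a1 <;> fin_cases a2 <;> fin_cases b1 <;> fin_cases b2 <;>
      simp [sigmaPlus, sigmaMinus, occ, emp]
    all_goals ring_nf
    simp
  · have h1 : η ≠ ζ := fun h => hout fun i _ _ => by rw [h]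
    have h2 : η ≠ exchange k ζ := fun h => hout fun i hi hi' => by
      rw [h, exchange_of_ne ζ hi hi']
    simp [hout, h1, h2]

lemma generator_eq_weightedGenerator (hL : 2 ≤ L) (w q β : ℂ) :
    generator L w q q β = weightedGenerator w q fun k => if (k : ℕ) + 1 = L then β else 1 := by
  ext η ζ
  rw [generator, Matrix.sum_apply, weightedGenerator, Matrix.of_apply]
  refine Finset.sum_congr rfl fun k _ => ?_
  rw [← hopping_apply hL]
  split_ifs <;> simp

/-- The branch of the logarithm is immaterial, because only an integer power of `q` appears. -/
lemma generator_eq_conditionedGenerator (hL : 2 ≤ L) (w : ℂ) {q : ℂ} (hq : q ≠ 0) (M : ℕ) :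
    generator L w q q (q ^ (-(2 * M : ℤ))) =
      conditionedGenerator L w q 0 (-2 * (M : ℂ) * Complex.log q) := by
  have h : Complex.exp (-2 * (M : ℂ) * Complex.log q) = q ^ (-(2 * M : ℤ)) := by
    have := Complex.exp_int_mul (Complex.log q) (-(2 * M : ℤ))
    rw [Complex.exp_log hq] at this
    rw [← this]
    push_cast
    ring_nf
  rw [generator_eq_weightedGenerator hL]
  simp only [weightedGenerator, conditionedGenerator, jumpWeight, zero_add, Complex.exp_zero, h]

lemma weightedGenerator_mul_apply (w q : ℂ) (a : Fin L → ℂ) (D : Matrix (Config L) (Config L) ℂ)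
    (η x : Config L) :
    (weightedGenerator w q a * D) η x = ∑ k, (bondRate w q 1 k η * D η x
      - bondRate w q (a k) k (exchange k η) * D (exchange k η) x) := by
  simp only [Matrix.mul_apply, weightedGenerator, Matrix.of_apply, Finset.sum_mul]
  rw [Finset.sum_comm]
  refine Finset.sum_congr rfl fun k _ => ?_
  simp [sub_mul, Finset.sum_sub_distrib, ite_mul, eq_exchange_comm k η]

lemma mul_weightedGenerator_apply (w q : ℂ) (a : Fin L → ℂ) (D : Matrix (Config L) (Config L) ℂ)
    (η x : Config L) :
    (D * weightedGenerator w q a) η x = ∑ k, (D η x * bondRate w q 1 k x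
      - D η (exchange k x) * bondRate w q (a k) k x) := by
  simp only [Matrix.mul_apply, weightedGenerator, Matrix.of_apply, Finset.mul_sum]
  rw [Finset.sum_comm]
  refine Finset.sum_congr rfl fun k _ => ?_
  simp [mul_sub, Finset.sum_sub_distrib, mul_ite]

/-! ### The shock measures under the exchange of neighbouring sites -/

/-- The exponent `∑_{k ∈ x, i ∈ η} sgn (i - k)` of `q` in the weight of `η` under the shock
measure at `x`. -/
def shockExponent (η x : Config L) : ℤ :=
  ∑ k, ∑ i, ((x k : ℕ) : ℤ) * ((η i : ℕ) : ℤ) *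
    ((if k < i then 1 else 0) - (if i < k then 1 else 0))

/-- The indicator that every shock of `x` sits on a particle of `η`. -/
noncomputable def covers (η x : Config L) : ℂ := ∏ k, if x k = 1 then ((η k : ℕ) : ℂ) else 1

/-- Antisymmetry of sgn exchanges the roles of particles and shocks, so moves of `η` reduce to moves
of `x`. -/
lemma shockExponent_swap (η x : Config L) : shockExponent η x = -shockExponent x η := by
  rw [shockExponent, Finset.sum_comm, shockExponent, ← Finset.sum_neg_distrib]
  refine Finset.sum_congr rfl fun i _ => ?_
  rw [← Finset.sum_neg_distrib]
  refine Finset.sum_congr rfl fun k _ => ?_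
  ring

lemma zpow_sum {ι : Type*} {q : ℂ} (hq : q ≠ 0) (s : Finset ι) (f : ι → ℤ) :
    q ^ ∑ i ∈ s, f i = ∏ i ∈ s, q ^ f i := by
  classical
  induction s using Finset.induction_on with
  | empty => simp
  | insert i s hi ih => rw [Finset.sum_insert hi, Finset.prod_insert hi, zpow_add₀ hq, ih]

/-- The prefactor is invariant under exchanges in `η` and in `x`, so only the last bracket enters
the bond computation. -/
lemma shockMeasure_eq {q : ℂ} (hq : q ≠ 0) (z : ℂ) (x η : Config L) :
    shockMeasure q z x η = z⁻¹ ^ particleNumber x * homogeneous L z η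
      * (covers η x * q ^ shockExponent η x) := by
  have hexp : q ^ shockExponent η x = ∏ k, q ^ (((x k : ℕ) : ℤ) *
      (-(∑ i with i < k, ((η i : ℕ) : ℤ)) + ∑ i with k < i, ((η i : ℕ) : ℤ))) := by
    rw [← zpow_sum hq, shockExponent]
    congr 1
    refine Finset.sum_congr rfl fun k _ => ?_
    rw [Finset.sum_filter, Finset.sum_filter, ← Finset.sum_neg_distrib, ← Finset.sum_add_distrib,
      Finset.mul_sum]
    refine Finset.sum_congr rfl fun i _ => ?_
    split_ifs <;> ring
  rw [shockMeasure, hexp, covers, particleNumber, ← Finset.prod_pow_eq_pow_sum, Finset.prod_filter,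
    ← Finset.prod_mul_distrib, mul_right_comm, ← Finset.prod_mul_distrib]
  congr 1
  refine Finset.prod_congr rfl fun k _ => ?_
  have hx : x k = 0 ∨ x k = 1 := by omega
  rcases hx with hx | hx <;> simp [hx, shockFactor]
  ring

lemma sum_exchange_mul (hL : 2 ≤ L) (k : Fin L) (x : Config L) (f : Fin L → ℤ) :
    ∑ i, ((exchange k x i : ℕ) : ℤ) * f i = ∑ i, ((x i : ℕ) : ℤ) * f i
      + (((x (next k) : ℕ) : ℤ) - ((x k : ℕ) : ℤ)) * (f k - f (next k)) := by
  have hne := next_ne hL k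
  rw [← Equiv.sum_comp (Equiv.swap k (next k))]
  have h (i : Fin L) : ((exchange k x (Equiv.swap k (next k) i) : ℕ) : ℤ)
      * f (Equiv.swap k (next k) i) = ((x i : ℕ) : ℤ) * f i
        + (if i = k then ((x k : ℕ) : ℤ) * (f (next k) - f k) else 0)
        + (if i = next k then ((x (next k) : ℕ) : ℤ) * (f k - f (next k)) else 0) := by
    by_cases hi : i = k
    · subst hi
      simp [hne.symm]
      ring
    by_cases hi' : i = next k
    · subst hi'
      simp [hne]
      ring
    simp [hi, hi', Equiv.swap_apply_of_ne_of_ne hi hi', exchange_of_ne x hi hi']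
  simp only [h, Finset.sum_add_distrib, Finset.sum_ite_eq', Finset.mem_univ, if_true]
  ring

lemma shockExponent_exchange_right (hL : 2 ≤ L) (k : Fin L) (η x : Config L) :
    shockExponent η (exchange k x) = shockExponent η x
      + (((x (next k) : ℕ) : ℤ) - ((x k : ℕ) : ℤ)) * (((η k : ℕ) : ℤ) + ((η (next k) : ℕ) : ℤ)
        - if (k : ℕ) + 1 = L then 2 * (particleNumber η : ℤ) else 0) := by
  have hne := next_ne hL k
  simp only [shockExponent, mul_assoc, ← Finset.mul_sum]
  rw [sum_exchange_mul hL]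
  congr 2
  rw [← Finset.sum_sub_distrib]
  have h (i : Fin L) : ((η i : ℕ) : ℤ) * ((if k < i then 1 else 0) - (if i < k then 1 else 0))
      - ((η i : ℕ) : ℤ) * ((if next k < i then 1 else 0) - (if i < next k then 1 else 0)) =
      (if i = k then ((η k : ℕ) : ℤ) else 0)
      + (if i = next k then ((η (next k) : ℕ) : ℤ) else 0)
      - ((η i : ℕ) : ℤ) * (if (k : ℕ) + 1 = L then 2 else 0) := by
    have hn := val_next k
    have hi1 : (i = k → η k = η i) := fun h => by rw [h]
    have hi2 : (i = next k → η (next k) = η i) := fun h => by rw [h]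
    -- In the bulk, sgn(i - k) - sgn(i - k - 1) is 1 at the two sites of the bond and 0 elsewhere.
    -- At the bond (L, 1) the order is reversed, which lowers every value by 2; summed against `η`
    -- this gives twice the particle number.
    have hs : ((if k < i then 1 else 0) - (if i < k then 1 else 0) : ℤ)
        - ((if next k < i then 1 else 0) - (if i < next k then 1 else 0)) =
        (if i = k then 1 else 0) + (if i = next k then 1 else 0)
        - (if (k : ℕ) + 1 = L then 2 else 0) := by
      simp only [Fin.lt_def, Fin.ext_iff]
      have := i.isLt
      have := k.isLt
      split_ifs at * <;> omega
    rw [← mul_sub, hs, mul_sub, mul_add]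
    congr 2
    · split_ifs with h <;> simp [h]
    · split_ifs with h <;> simp [h]
  simp only [h, Finset.sum_add_distrib, Finset.sum_sub_distrib, Finset.sum_ite_eq',
    Finset.mem_univ, if_true, ← Finset.sum_mul, particleNumber]
  push_cast
  split_ifs <;> ring

lemma shockExponent_exchange_left (hL : 2 ≤ L) (k : Fin L) (η x : Config L) :
    shockExponent (exchange k η) x = shockExponent η x
      - (((η (next k) : ℕ) : ℤ) - ((η k : ℕ) : ℤ)) * (((x k : ℕ) : ℤ) + ((x (next k) : ℕ) : ℤ)
        - if (k : ℕ) + 1 = L then 2 * (particleNumber x : ℤ) else 0) := by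
  rw [shockExponent_swap, shockExponent_exchange_right hL, shockExponent_swap η x]
  ring

lemma covers_eq_mul (hL : 2 ≤ L) (k : Fin L) (η x : Config L) :
    covers η x = (∏ i ∈ Finset.univ \ {k, next k}, if x i = 1 then ((η i : ℕ) : ℂ) else 1)
      * ((if x k = 1 then ((η k : ℕ) : ℂ) else 1)
        * if x (next k) = 1 then ((η (next k) : ℕ) : ℂ) else 1) := by
  rw [covers, ← Finset.prod_sdiff (Finset.subset_univ {k, next k}),
    Finset.prod_pair (next_ne hL k).symm]

/-- The parts of the two generators that belong to one bond intertwine the shock measures up to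
a discrete gradient. -/
lemma bond_intertwining (hL : 2 ≤ L) (w : ℂ) {q : ℂ} (hq : q ≠ 0) (k : Fin L) (η x : Config L) :
    (bondRate w q 1 k η * (covers η x * q ^ shockExponent η x)
      - bondRate w q (if (k : ℕ) + 1 = L then q ^ (-(2 * particleNumber x : ℤ)) else 1) k
          (exchange k η)
        * (covers (exchange k η) x * q ^ shockExponent (exchange k η) x))
    - ((covers η x * q ^ shockExponent η x) * bondRate w q 1 k x
      - (covers η (exchange k x) * q ^ shockExponent η (exchange k x))
        * bondRate w q (if (k : ℕ) + 1 = L then q ^ (-(2 * particleNumber η : ℤ)) else 1) k x)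
    = w * (q - q⁻¹) * (covers η x * q ^ shockExponent η x)
      * ((((η k : ℕ) : ℂ) - ((x k : ℕ) : ℂ)) - (((η (next k) : ℕ) : ℂ) - ((x (next k) : ℕ) : ℂ))) := by
  have hout (η : Config L) (i : Fin L) (hi : i ∈ Finset.univ \ {k, next k}) :
      exchange k η i = η i := by
    simp only [Finset.mem_sdiff, Finset.mem_univ, true_and, Finset.mem_insert,
      Finset.mem_singleton, not_or] at hi
    exact exchange_of_ne η hi.1 hi.2
  have hl : covers (exchange k η) x =
      (∏ i ∈ Finset.univ \ {k, next k}, if x i = 1 then ((η i : ℕ) : ℂ) else 1)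
      * ((if x k = 1 then ((η (next k) : ℕ) : ℂ) else 1)
        * if x (next k) = 1 then ((η k : ℕ) : ℂ) else 1) := by
    rw [covers_eq_mul hL k, exchange_self, exchange_next]
    congr 1
    exact Finset.prod_congr rfl fun i hi => by rw [hout η i hi]
  have hr : covers η (exchange k x) =
      (∏ i ∈ Finset.univ \ {k, next k}, if x i = 1 then ((η i : ℕ) : ℂ) else 1)
      * ((if x (next k) = 1 then ((η k : ℕ) : ℂ) else 1)
        * if x k = 1 then ((η (next k) : ℕ) : ℂ) else 1) := by
    rw [covers_eq_mul hL k, exchange_self, exchange_next]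
    congr 1
    exact Finset.prod_congr rfl fun i hi => by rw [hout x i hi]
  -- Bulk and boundary weights take one form, with exponent 0 in the bulk. The bond identity then
  -- holds for arbitrary integer exponents `m` and `n`, leaving sixteen local occupation patterns to
  -- check.
  have hw (n : ℕ) : (if (k : ℕ) + 1 = L then q ^ (-(2 * n : ℤ)) else 1) =
      (q ^ (if (k : ℕ) + 1 = L then 2 * n else 0 : ℤ))⁻¹ := by
    split_ifs <;> simp
  rw [hl, hr, covers_eq_mul hL k η x, shockExponent_exchange_left hL,
    shockExponent_exchange_right hL, hw, hw]
  simp only [bondRate, exchange_self, exchange_next]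
  generalize (∏ i ∈ Finset.univ \ {k, next k}, if x i = 1 then ((η i : ℕ) : ℂ) else 1) = c
  generalize shockExponent η x = e
  generalize (if (k : ℕ) + 1 = L then 2 * (particleNumber x : ℤ) else 0) = m
  generalize (if (k : ℕ) + 1 = L then 2 * (particleNumber η : ℤ) else 0) = n
  generalize η k = a1
  generalize η (next k) = a2
  generalize x k = b1
  generalize x (next k) = b2
  have hm : q ^ m ≠ 0 := zpow_ne_zero _ hq
  have hn : q ^ n ≠ 0 := zpow_ne_zero _ hq
  fin_cases a1 <;> fin_cases a2 <;> fin_cases b1 <;> fin_cases b2 <;>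
    simp [zpow_add₀ hq, zpow_sub₀ hq] <;> field_simp <;> ring

/-! ### The intertwining relation -/

/-- The matrix whose columns are the shock measures with `K` shocks, restricted to `N`
particles. -/
noncomputable def shockMatrix (L N K : ℕ) (q z : ℂ) : Matrix (Config L) (Config L) ℂ :=
  Matrix.of fun η x => if x ∈ sector L K then shockMeasureN N q z x η else 0

lemma shockMatrix_apply {q : ℂ} (hq : q ≠ 0) (z : ℂ) (N K : ℕ) (η x : Config L) :
    shockMatrix L N K q z η x =
      (if particleNumber x = K ∧ particleNumber η = N then
        z⁻¹ ^ particleNumber x * homogeneous L z η else 0)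
      * (covers η x * q ^ shockExponent η x) := by
  simp only [shockMatrix, Matrix.of_apply, shockMeasureN, projector, Matrix.mulVec_diagonal,
    mem_sector, shockMeasure_eq hq]
  by_cases hx : particleNumber x = K <;> by_cases hη : particleNumber η = N <;> simp [hx, hη]

lemma projector_mul_shockMatrix (N K : ℕ) (q z : ℂ) :
    projector L N * shockMatrix L N K q z = shockMatrix L N K q z := by
  ext η x
  simp only [projector, Matrix.diagonal_mul, shockMatrix, Matrix.of_apply, shockMeasureN,
    Matrix.mulVec_diagonal]
  split_ifs <;> simp

lemma shockMatrix_mul_projector (N K : ℕ) (q z : ℂ) :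
    shockMatrix L N K q z * projector L K = shockMatrix L N K q z := by
  ext η x
  simp only [projector, Matrix.mul_diagonal, shockMatrix, Matrix.of_apply]
  split_ifs <;> simp

lemma generator_mul_shockMatrix (hL : 2 ≤ L) (w : ℂ) {q : ℂ} (hq : q ≠ 0) (z : ℂ) (N K : ℕ) :
    generator L w q q (q ^ (-(2 * K : ℤ))) * shockMatrix L N K q z =
      shockMatrix L N K q z * generator L w q q (q ^ (-(2 * N : ℤ))) := by
  ext η x
  rw [generator_eq_weightedGenerator hL, generator_eq_weightedGenerator hL,
    weightedGenerator_mul_apply, mul_weightedGenerator_apply]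
  simp only [shockMatrix_apply hq, particleNumber_exchange, homogeneous_exchange]
  by_cases h : particleNumber x = K ∧ particleNumber η = N
  -- On these sectors `K` and `N` are the particle numbers of `x` and `η`, as the bond identity
  -- requires. Outside them both sides vanish, since exchanges preserve particle numbers.
  · obtain ⟨rfl, rfl⟩ := h
    rw [← sub_eq_zero, ← Finset.sum_sub_distrib]
    simp only [and_self, if_true]
    set c := z⁻¹ ^ particleNumber x * homogeneous L z η
    set d := covers η x * q ^ shockExponent η x
    let g : Fin L → ℂ := fun k => ((η k : ℕ) : ℂ) - ((x k : ℕ) : ℂ)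
    -- Rotating the ring permutes the sites, so the gradient of `g` sums to zero.
    have hg : ∑ k, g (next k) = ∑ k, g k := Equiv.sum_comp (finRotate L) g
    trans ∑ k, c * (w * (q - q⁻¹) * d) * (g k - g (next k))
    · refine Finset.sum_congr rfl fun k _ => ?_
      linear_combination c * bond_intertwining hL w hq k η x
    · rw [← Finset.mul_sum, Finset.sum_sub_distrib, hg, sub_self, mul_zero]
  · simp [h]

/-- The rows of `D` live on `N` particles and its columns on `K`, so it absorbs both projectors; no
separate commutation of the generators with the projectors is needed. -/
lemma localGenerator_mul_shockMatrix (hL : 2 ≤ L) (w : ℂ) {q : ℂ} (hq : q ≠ 0) (z : ℂ)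
    (N K : ℕ) :
    localGenerator L N K w q * shockMatrix L N K q z =
      shockMatrix L N K q z * localGenerator L K N w q := by
  have h := generator_mul_shockMatrix hL w hq z N K
  have hP := projector_mul_shockMatrix (L := L) N K q z
  have hQ := shockMatrix_mul_projector (L := L) N K q z
  simp only [localGenerator, restrict]
  set A := generator L w q q (q ^ (-(2 * K : ℤ)))
  set B := generator L w q q (q ^ (-(2 * N : ℤ)))
  set D := shockMatrix L N K q z
  calc projector L N * A * projector L N * D = projector L N * (A * (projector L N * D)) := by
        simp only [Matrix.mul_assoc]
    _ = projector L N * D * B := by rw [hP, h, ← Matrix.mul_assoc, hP]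
    _ = A * (D * projector L K) := by rw [hP, hQ, h]
    _ = D * projector L K * B * projector L K := by rw [← Matrix.mul_assoc, h, hQ]
    _ = D * (projector L K * B * projector L K) := by simp only [Matrix.mul_assoc]

/-! ### From the generators to the semigroups -/

lemma evolution_mul_of_mul_eq {A B D : Matrix (Config L) (Config L) ℂ} (h : A * D = D * B)
    (t : ℝ) : evolution A t * D = D * evolution B t := by
  -- The norm is auxiliary: it supplies the convergence of the exponential series and does not enter
  -- the statement.
  let _ : NormedRing (Matrix (Config L) (Config L) ℂ) := Matrix.linftyOpNormedRing
  let _ : NormedAlgebra ℂ (Matrix (Config L) (Config L) ℂ) := Matrix.linftyOpNormedAlgebra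
  let _ : NormedAlgebra ℚ (Matrix (Config L) (Config L) ℂ) := .restrictScalars ℚ ℂ _
  have hs : SemiconjBy D (-(t : ℂ) • B) (-(t : ℂ) • A) := by
    rw [SemiconjBy, Matrix.mul_smul, Matrix.smul_mul, h]
  exact hs.exp_right.eq.symm

end ASEP

theorem theorem3 (L : ℕ) (hL : 2 ≤ L) (w q z : ℂ) (hq : q ≠ 0) (hz : z ≠ 0)
    (K N : ℕ) :
    -- the generators are those of the ASEP conditioned only at the boundary bond, with driving
    -- strengths `-2 K ln q` (for `N` particles) and `-2 N ln q` (for `K` particles)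
    ASEP.localGenerator L N K w q =
        ASEP.restrict N (ASEP.conditionedGenerator L w q 0 (-2 * (K : ℂ) * Complex.log q)) ∧
    ASEP.localGenerator L K N w q =
        ASEP.restrict K (ASEP.conditionedGenerator L w q 0 (-2 * (N : ℂ) * Complex.log q)) ∧
    -- evolution of the shock/antishock measures with `K` shocks
    ∀ x ∈ ASEP.sector L K, ∀ t : ℝ,
      Matrix.mulVec (ASEP.evolution (ASEP.localGenerator L N K w q) t)
          (ASEP.shockMeasureN N q z x) =
        ∑ y ∈ ASEP.sector L K,
          ASEP.evolution (ASEP.localGenerator L K N w q) t y x • ASEP.shockMeasureN N q z y := by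
  refine ⟨?_, ?_, fun x hx t => ?_⟩
  · rw [ASEP.localGenerator, ASEP.generator_eq_conditionedGenerator hL w hq]
  · rw [ASEP.localGenerator, ASEP.generator_eq_conditionedGenerator hL w hq]
  · funext η
    -- Entry `(η, x)` of the exponentiated intertwining relation; expanding the product on the right
    -- gives the sum over `y`.
    have h := congrFun (congrFun (ASEP.evolution_mul_of_mul_eq
      (ASEP.localGenerator_mul_shockMatrix hL w hq z N K) t) η) x
    simp only [Matrix.mul_apply, ASEP.shockMatrix, Matrix.of_apply, hx, if_true, ite_mul,
      zero_mul] at h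
    rw [Finset.sum_apply, Matrix.mulVec, dotProduct, h, Finset.sum_ite_mem, Finset.univ_inter]
    exact Finset.sum_congr rfl fun y _ => mul_comm _ _
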